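/- Let $M$ be a $2m$-dimensional almost Hermitian manifold (smooth, without boundary) with Riemannian metric $g$, almost complex structure $J$ (so $J^2=-1$, $g(JX,JY)=g(X,Y)$) and Levi-Civita connection $\nabla$, and let $R(X,Y,Z,U)=g(\nabla_X\nabla_YZ-\nabla_Y\nabla_XZ-\nabla_{[X,Y]}Z,U)$. Define $$R^*(X,Y,Z,U)=\tfrac{3}{16}\{R(X,Y,Z,U)+R(X,Y,JZ,JU)+R(JX,JY,Z,U)+R(JX,JY,JZ,JU)\}$$ $$+\tfrac1{16}\{R(JX,JZ,Y,U)-R(JY,JZ,X,U)+R(X,Z,JY,JU)-R(Y,Z,JX,JU)$$ $$+R(Y,JZ,JX,U)-R(X,JZ,JY,U)+R(JY,Z,X,JU)-R(JX,Z,Y,JU)\},$$ and, for an orthonormal frame $\{E_i\}_{i=1}^{2m}$, $S^*(X,Y)=\sum_i R^*(X,E_i,E_i,Y)$ and $\tau^*=\sum_i S^*(E_i,E_i)$. The generalized Bochner curvature tensor of $M$ is $$B^*=R^*-\frac1{2(m+2)}(\varphi+\psi)(S^*)+\frac{\tau^*}{4(m+1)(m+2)}(\pi_1+\pi_2),$$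 where, for a $(0,2)$-tensor $Q$, $$\varphi(Q)(X,Y,Z,U)=g(X,U)Q(Y,Z)-g(X,Z)Q(Y,U)+g(Y,Z)Q(X,U)-g(Y,U)Q(X,Z),$$ $$\psi(Q)(X,Y,Z,U)=g(X,JU)Q(Y,JZ)-g(X,JZ)Q(Y,JU)-2g(X,JY)Q(Z,JU)$$ $$+g(Y,JZ)Q(X,JU)-g(Y,JU)Q(X,JZ)-2g(Z,JU)Q(X,JY),$$ $$\pi_1(X,Y,Z,U)=g(X,U)g(Y,Z)-g(X,Z)g(Y,U),$$ $$\pi_2(X,Y,Z,U)=g(X,JU)g(Y,JZ)-g(X,JZ)g(Y,JU)-2g(X,JY)g(Z,JU).$$ Suppose that $M=M_1\times\dots\times M_n$ is a product of $n>2$ almost Hermitian manifolds $M_i$ of positive dimension, with the product metric and the product almost complex structure. Then $B^*=0$ on $M$ if and only if $M$ has zero holomorphic sectional curvature, that is, $R(X,JX,JX,X)=0$ for every unit tangent vector $X$ of $M$. -/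

import Mathlib

open Set
open scoped Manifold ContDiff Bundle

/-! ### A finite product of manifolds is a manifold -/

section PiManifold

variable {ι : Type*} [Fintype ι]
  {E : ι → Type*} [∀ i, NormedAddCommGroup (E i)] [∀ i, NormedSpace ℝ (E i)]
  {H : ι → Type*} [∀ i, TopologicalSpace (H i)]
  (I : ∀ i, ModelWithCorners ℝ (E i) (H i))
  (M : ι → Type*) [∀ i, TopologicalSpace (M i)] [∀ i, ChartedSpace (H i) (M i)]

instance isManifoldPi (n : ℕ∞ω) [∀ i, IsManifold (I i) n (M i)] :
    IsManifold (ModelWithCorners.pi I) n (∀ i, M i) := by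
  apply isManifold_of_contDiffOn
  rintro _ _ ⟨e, he, rfl⟩ ⟨e', he', rfl⟩
  rw [contDiffOn_pi]
  intro i
  have hi : ContDiffOn ℝ n (I i ∘ ((e i).symm ≫ₕ e' i) ∘ (I i).symm)
      ((I i).symm ⁻¹' ((e i).symm ≫ₕ e' i).source ∩ range (I i)) :=
    (contDiffGroupoid n (I i)).compatible (he i (mem_univ i)) (he' i (mem_univ i)) |>.1
  have hp : ContDiffOn ℝ n (fun x : ∀ i, E i => x i)
      ((ModelWithCorners.pi I).symm ⁻¹'
          ((OpenPartialHomeomorph.pi e).symm ≫ₕ OpenPartialHomeomorph.pi e').source ∩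
        range (ModelWithCorners.pi I)) :=
    (ContinuousLinearMap.proj (R := ℝ) (φ := E) i).contDiff.contDiffOn
  refine hi.comp hp ?_
  rintro x ⟨⟨hx₁, hx₂⟩, ⟨y, rfl⟩⟩
  exact ⟨⟨hx₁ i (mem_univ i), hx₂ i (mem_univ i)⟩, ⟨y i, rfl⟩⟩

end PiManifold

/-! ### Tensors on a vector space with an endomorphism `J` and a bilinear form `g` -/

namespace HermitianAlgebra

section

variable {V : Type*} (J : V → V) (g : V → V → ℝ)

/-- The tensor `R*` built from a curvature tensor `R`. -/
noncomputable def starTensor (R : V → V → V → V → ℝ) (X Y Z U : V) : ℝ :=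
  3 / 16 * (R X Y Z U + R X Y (J Z) (J U) + R (J X) (J Y) Z U + R (J X) (J Y) (J Z) (J U)) +
  1 / 16 * (R (J X) (J Z) Y U - R (J Y) (J Z) X U + R X Z (J Y) (J U) - R Y Z (J X) (J U) +
    R Y (J Z) (J X) U - R X (J Z) (J Y) U + R (J Y) Z X (J U) - R (J X) Z Y (J U))

def phi (Q : V → V → ℝ) (X Y Z U : V) : ℝ :=
  g X U * Q Y Z - g X Z * Q Y U + g Y Z * Q X U - g Y U * Q X Z

def psi (Q : V → V → ℝ) (X Y Z U : V) : ℝ :=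
  g X (J U) * Q Y (J Z) - g X (J Z) * Q Y (J U) - 2 * g X (J Y) * Q Z (J U) +
    g Y (J Z) * Q X (J U) - g Y (J U) * Q X (J Z) - 2 * g Z (J U) * Q X (J Y)

def pi₁ (X Y Z U : V) : ℝ :=
  g X U * g Y Z - g X Z * g Y U

def pi₂ (X Y Z U : V) : ℝ :=
  g X (J U) * g Y (J Z) - g X (J Z) * g Y (J U) - 2 * g X (J Y) * g Z (J U)

/-- The Ricci contraction `∑ i, R(X, e i, e i, Y)` with respect to a frame `e`. -/
def ricciTrace {κ : Type*} [Fintype κ] (e : κ → V) (R : V → V → V → V → ℝ) (X Y : V) : ℝ :=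
  ∑ i, R X (e i) (e i) Y

/-- The scalar contraction `∑ i, S(e i, e i)` with respect to a frame `e`. -/
def scalarTrace {κ : Type*} [Fintype κ] (e : κ → V) (S : V → V → ℝ) : ℝ :=
  ∑ i, S (e i) (e i)

/-- The generalized Bochner tensor of a curvature tensor `R`, in real dimension `2 m`, the traces
being taken with respect to the frame `e` (to be used with `g`-orthonormal frames). -/
noncomputable def bochnerStar {κ : Type*} [Fintype κ] (e : κ → V) (m : ℝ)
    (R : V → V → V → V → ℝ) (X Y Z U : V) : ℝ :=
  let Rs := starTensor J R
  let Ss := ricciTrace e Rs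
  let τs := scalarTrace e Ss
  Rs X Y Z U - 1 / (2 * (m + 2)) * (phi g Ss X Y Z U + psi J g Ss X Y Z U) +
    τs / (4 * (m + 1) * (m + 2)) * (pi₁ g X Y Z U + pi₂ J g X Y Z U)

end

end HermitianAlgebra

/-! ### Levi-Civita connection and curvature of a metric on a vector space

`G` is a field of bilinear forms on a normed space `E` (a Riemannian metric read in a chart);
vector fields are functions `E → E`. -/

namespace LocalMetric

variable {E : Type*} [NormedAddCommGroup E] [NormedSpace ℝ E]

/-- The Christoffel map: where `G y` is nondegenerate, `christoffel G y a b` is the vector with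
`G y (Γ(a, b)) c = 1/2 * (∂_a G (b, c) + ∂_b G (a, c) - ∂_c G (a, b))` for all `c`. -/
noncomputable def christoffel (G : E → E →L[ℝ] E →L[ℝ] ℝ) (y a b : E) : E :=
  (G y).inverse ((1 / 2 : ℝ) •
    (fderiv ℝ G y a b + fderiv ℝ G y b a - ((fderiv ℝ G y).flip a).flip b))

/-- The Levi-Civita covariant derivative `∇_X Y`. -/
noncomputable def covDeriv (G : E → E →L[ℝ] E →L[ℝ] ℝ) (X Y : E → E) (y : E) : E :=
  fderiv ℝ Y y (X y) + christoffel G y (X y) (Y y)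

/-- `R(X, Y) Z = ∇_X ∇_Y Z - ∇_Y ∇_X Z - ∇_[X, Y] Z`. -/
noncomputable def curvature (G : E → E →L[ℝ] E →L[ℝ] ℝ) (X Y Z : E → E) (y : E) : E :=
  covDeriv G X (covDeriv G Y Z) y - covDeriv G Y (covDeriv G X Z) y -
    covDeriv G (VectorField.lieBracket ℝ X Y) Z y

end LocalMetric

/-! ### Almost Hermitian manifolds -/

section AlmostHermitian

variable {E : Type*} [NormedAddCommGroup E] [NormedSpace ℝ E]
  {H : Type*} [TopologicalSpace H] (I : ModelWithCorners ℝ E H)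
  (M : Type*) [TopologicalSpace M] [ChartedSpace H M] [IsManifold I ∞ M]

/-- An almost Hermitian structure on a smooth manifold: a smooth Riemannian metric `g` and a smooth
almost complex structure `J` that is orthogonal for `g`. -/
structure AlmostHermitian where
  g : Bundle.ContMDiffRiemannianMetric I ∞ E (fun x : M => TangentSpace I x)
  J : ∀ x : M, TangentSpace I x →L[ℝ] TangentSpace I x
  contMDiff_J : ContMDiff I (I.prod 𝓘(ℝ, E →L[ℝ] E)) ∞
    (fun x => Bundle.TotalSpace.mk' (E →L[ℝ] E)
      (E := fun x : M => TangentSpace I x →L[ℝ] TangentSpace I x) x (J x))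
  J_J : ∀ (x : M) (u : TangentSpace I x), J x (J x u) = -u
  g_J_J : ∀ (x : M) (u v : TangentSpace I x), g.inner x (J x u) (J x v) = g.inner x u v

end AlmostHermitian

namespace AlmostHermitian

section

variable {E : Type*} [NormedAddCommGroup E] [NormedSpace ℝ E]
  {H : Type*} [TopologicalSpace H] {I : ModelWithCorners ℝ E H}
  {M : Type*} [TopologicalSpace M] [ChartedSpace H M] [IsManifold I ∞ M]
  (A : AlmostHermitian I M)

/-- The metric read in the preferred chart at `p`: the pullback of `g` under the inverse chart. -/
noncomputable def chartMetric (p : M) (y : E) : E →L[ℝ] E →L[ℝ] ℝ :=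
  let gy : E →L[ℝ] E →L[ℝ] ℝ := A.g.inner ((extChartAt I p).symm y)
  let D : E →L[ℝ] E := mfderiv 𝓘(ℝ, E) I (extChartAt I p).symm y
  gy.bilinearComp D D

/-- The curvature tensor `R(u, v, w, z) = g(R(u, v) w, z)` at `p`. In Mathlib the tangent space
`TangentSpace I p` is the model space `E`, a vector being identified with its coordinates in the
preferred chart at `p`; so `u, v, w` are extended as constant coordinate vector fields. -/
noncomputable def Rm (p : M) (u v w z : TangentSpace I p) : ℝ :=
  A.g.inner p
    (LocalMetric.curvature (A.chartMetric p) (fun _ => u) (fun _ => v) (fun _ => w)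
      (extChartAt I p p) : E) z

/-- The holomorphic sectional curvature of `M` is zero. -/
def ZeroHolomorphicSectionalCurvature : Prop :=
  ∀ (p : M) (u : TangentSpace I p), A.g.inner p u u = 1 → A.Rm p u (A.J p u) (A.J p u) u = 0

variable [FiniteDimensional ℝ E]

theorem exists_orthonormal (p : M) :
    ∃ e : Fin (Module.finrank ℝ E) → TangentSpace I p,
      ∀ i j, A.g.inner p (e i) (e j) = if i = j then 1 else 0 := by
  let _ : Bundle.RiemannianBundle (fun x : M => TangentSpace I x) := ⟨A.g.toRiemannianMetric⟩
  have : FiniteDimensional ℝ (TangentSpace I p) := inferInstanceAs (FiniteDimensional ℝ E)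
  let e := stdOrthonormalBasis ℝ (TangentSpace I p)
  exact ⟨fun i => e i, fun i j => orthonormal_iff_ite.mp e.orthonormal i j⟩

/-- A `g`-orthonormal frame of the tangent space at `p`. -/
noncomputable def frame (p : M) : Fin (Module.finrank ℝ E) → TangentSpace I p :=
  (A.exists_orthonormal p).choose

/-- The generalized Bochner curvature tensor `B*` at `p`. -/
noncomputable def Bstar (p : M) (X Y Z U : TangentSpace I p) : ℝ :=
  HermitianAlgebra.bochnerStar (A.J p) (fun u v => A.g.inner p u v) (A.frame p)
    ((Module.finrank ℝ E : ℝ) / 2) (A.Rm p) X Y Z U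

def BstarVanishes : Prop :=
  ∀ (p : M) (X Y Z U : TangentSpace I p), A.Bstar p X Y Z U = 0

end

section Product

variable {ι : Type*} [Fintype ι]
  {E : ι → Type*} [∀ i, NormedAddCommGroup (E i)] [∀ i, NormedSpace ℝ (E i)]
  {H : ι → Type*} [∀ i, TopologicalSpace (H i)]
  {I : ∀ i, ModelWithCorners ℝ (E i) (H i)}
  {M : ι → Type*} [∀ i, TopologicalSpace (M i)] [∀ i, ChartedSpace (H i) (M i)]
  [∀ i, IsManifold (I i) ∞ (M i)]

/-- The almost Hermitian structure `P` on the product manifold `∏ i, M i` is the product of the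
structures `A i`: with `T_x (∏ i, M i) = ∏ i, T_(x i) (M i)`, the metric is the orthogonal sum of
the metrics of the factors and the almost complex structure acts factor by factor. -/
structure IsProduct (P : AlmostHermitian (ModelWithCorners.pi I) (∀ i, M i))
    (A : ∀ i, AlmostHermitian (I i) (M i)) : Prop where
  g_eq : ∀ (x : ∀ i, M i) (u v : ∀ i, TangentSpace (I i) (x i)),
    P.g.inner x u v = ∑ i, (A i).g.inner (x i) (u i) (v i)
  J_eq : ∀ (x : ∀ i, M i) (u : ∀ i, TangentSpace (I i) (x i)) (i : ι),
    (P.J x u : ∀ i, TangentSpace (I i) (x i)) i = (A i).J (x i) (u i)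

end Product

end AlmostHermitian

set_option maxSynthPendingDepth 3

/-! The averaging that defines R* does two things. Each value of R* is a linear combination of
polarized values of x ↦ R(x, Jx, Jx, x) (`starTensor_eq_zero`), and R*(x, Jx, Jx, x) = R(x, Jx, Jx,
x) (`starTensor_self_J`). The first property gives one implication on any almost Hermitian manifold:
if the holomorphic sectional curvature vanishes, then so do R*, its traces and B*.

For the converse, R, J and g split over the factors, hence so do R* and S*. Take x and y tangent to
distinct factors. There R*(x, y, y, x) = 0, so B* = 0 becomes g(y,y) S*(x,x) + g(x,x) S*(y,y) = C
g(x,x) g(y,y) with C = τ*/(2(m+1)). A third factor provides enough such equations to solve for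
S*(x,x) = (C/2) g(x,x). Tracing gives τ* = mC, which forces τ* = 0, so S* vanishes on the diagonal.
Then B*(x, Jx, Jx, x) reduces to R(x, Jx, Jx, x) for x in a single factor, and the splitting of R
extends the vanishing to all vectors.

The geometric input is that the coordinate curvature has the Riemannian symmetries
(`isCurvatureLike_Rm`) and splits over a product (`Rm_eq_sum`). -/

/-! ### Curvature-like tensors -/

/-- A quadrilinear form with the symmetries of a Riemannian curvature tensor. -/
structure IsCurvatureLike {V : Type*} [AddCommGroup V] [Module ℝ V]
    (R : V → V → V → V → ℝ) : Prop where
  add₁ : ∀ a a' b c d, R (a + a') b c d = R a b c d + R a' b c d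
  smul₁ : ∀ (t : ℝ) a b c d, R (t • a) b c d = t * R a b c d
  swap₁₂ : ∀ a b c d, R b a c d = -R a b c d
  swap₃₄ : ∀ a b c d, R a b d c = -R a b c d
  bianchi : ∀ a b c d, R a b c d + R b c a d + R c a b d = 0

namespace IsCurvatureLike

variable {V : Type*} [AddCommGroup V] [Module ℝ V] {R : V → V → V → V → ℝ}
  (h : IsCurvatureLike R)

include h

/-- The octahedron argument: a combination of four Bianchi identities, one for each cyclic shift of
the arguments, with the two skew symmetries. -/
theorem pair_symm (a b c d : V) : R c d a b = R a b c d := by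
  linarith [h.bianchi a b c d, h.bianchi b c d a, h.bianchi c d a b, h.bianchi d a b c,
    h.swap₁₂ a c b d, h.swap₃₄ a c b d, h.swap₁₂ a c d b, h.swap₃₄ b c a d, h.swap₁₂ b d c a,
    h.swap₃₄ b d a c, h.swap₃₄ c d a b, h.swap₃₄ d a b c, h.swap₁₂ b d a c, h.swap₃₄ a b c d,
    h.swap₁₂ a d b c, h.swap₁₂ a d c b]

theorem add₂ (a b b' c d : V) : R a (b + b') c d = R a b c d + R a b' c d := by
  rw [h.swap₁₂, h.add₁, h.swap₁₂ a b, h.swap₁₂ a b']; ring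

theorem add₃ (a b c c' d : V) : R a b (c + c') d = R a b c d + R a b c' d := by
  rw [h.pair_symm, h.add₁, h.pair_symm a b c, h.pair_symm a b c']

theorem add₄ (a b c d d' : V) : R a b c (d + d') = R a b c d + R a b c d' := by
  rw [h.pair_symm, h.add₂, h.pair_symm a b c, h.pair_symm a b c]

theorem smul₂ (t : ℝ) (a b c d : V) : R a (t • b) c d = t * R a b c d := by
  rw [h.swap₁₂, h.smul₁, h.swap₁₂ a b]; ring

theorem smul₃ (t : ℝ) (a b c d : V) : R a b (t • c) d = t * R a b c d := by
  rw [h.pair_symm, h.smul₁, h.pair_symm a b]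

theorem smul₄ (t : ℝ) (a b c d : V) : R a b c (t • d) = t * R a b c d := by
  rw [h.pair_symm, h.smul₂, h.pair_symm a b]

theorem neg₁ (a b c d : V) : R (-a) b c d = -R a b c d := by
  rw [← neg_one_smul ℝ a, h.smul₁]; ring

theorem neg₂ (a b c d : V) : R a (-b) c d = -R a b c d := by
  rw [← neg_one_smul ℝ b, h.smul₂]; ring

theorem neg₃ (a b c d : V) : R a b (-c) d = -R a b c d := by
  rw [← neg_one_smul ℝ c, h.smul₃]; ring

theorem neg₄ (a b c d : V) : R a b c (-d) = -R a b c d := by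
  rw [← neg_one_smul ℝ d, h.smul₄]; ring

theorem zero₁ (b c d : V) : R 0 b c d = 0 := by
  simpa using h.smul₁ 0 0 b c d

theorem zero₂ (a c d : V) : R a 0 c d = 0 := by
  simpa using h.smul₂ 0 a 0 c d

theorem zero₃ (a b d : V) : R a b 0 d = 0 := by
  simpa using h.smul₃ 0 a b 0 d

/-- All permutations of the arguments in terms of `R a b c d` and `R a c b d`. -/
theorem permutations (a b c d : V) :
    R a b d c = -R a b c d ∧ R a c d b = -R a c b d ∧
    R a d b c = R a c b d - R a b c d ∧ R a d c b = R a b c d - R a c b d ∧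
    R b a c d = -R a b c d ∧ R b a d c = R a b c d ∧
    R b c a d = R a c b d - R a b c d ∧ R b c d a = R a b c d - R a c b d ∧
    R b d a c = R a c b d ∧ R b d c a = -R a c b d ∧
    R c a b d = -R a c b d ∧ R c a d b = R a c b d ∧
    R c b a d = R a b c d - R a c b d ∧ R c b d a = R a c b d - R a b c d ∧
    R c d a b = R a b c d ∧ R c d b a = -R a b c d ∧
    R d a b c = R a b c d - R a c b d ∧ R d a c b = R a c b d - R a b c d ∧
    R d b a c = -R a c b d ∧ R d b c a = R a c b d ∧
    R d c a b = -R a b c d ∧ R d c b a = R a b c d := by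
  have e1 := h.bianchi a b c d
  have e2 := h.swap₁₂ a c b d
  have e3 := h.pair_symm b c a d
  refine ⟨?_, ?_, ?_, ?_, ?_, ?_, ?_, ?_, ?_, ?_, ?_, ?_, ?_, ?_, ?_, ?_, ?_, ?_, ?_, ?_, ?_, ?_⟩ <;>
  linarith [h.swap₃₄ a b c d, h.swap₃₄ a c b d, h.swap₃₄ a d b c, h.swap₁₂ a b c d,
    h.swap₁₂ a b d c, h.swap₃₄ b c a d, h.pair_symm a c b d, h.swap₃₄ b d a c,
    h.swap₁₂ a c d b, h.swap₁₂ b c a d, h.swap₁₂ b c d a, h.pair_symm a b c d,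
    h.swap₃₄ c d a b, h.swap₁₂ a d b c, h.swap₁₂ a d c b, h.swap₁₂ b d a c, h.swap₁₂ b d c a,
    h.swap₁₂ c d a b, h.swap₁₂ c d b a]

end IsCurvatureLike

/-- Polarization of a quartic form that is given by a quadrilinear one. -/
theorem sum_permutations_eq_zero_of_diagonal {V : Type*} [AddCommGroup V] [Module ℝ V]
    {T : V → V → V → V → ℝ}
    (a₁ : ∀ x x' y z w, T (x + x') y z w = T x y z w + T x' y z w)
    (a₂ : ∀ x y y' z w, T x (y + y') z w = T x y z w + T x y' z w)
    (a₃ : ∀ x y z z' w, T x y (z + z') w = T x y z w + T x y z' w)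
    (a₄ : ∀ x y z w w', T x y z (w + w') = T x y z w + T x y z w')
    (s₁ : ∀ (t : ℝ) x y z w, T (t • x) y z w = t * T x y z w)
    (s₂ : ∀ (t : ℝ) x y z w, T x (t • y) z w = t * T x y z w)
    (s₃ : ∀ (t : ℝ) x y z w, T x y (t • z) w = t * T x y z w)
    (s₄ : ∀ (t : ℝ) x y z w, T x y z (t • w) = t * T x y z w)
    (h : ∀ x, T x x x x = 0) (a b c d : V) :
    T a b c d + T a b d c + T a c b d + T a c d b + T a d b c + T a d c b +
    T b a c d + T b a d c + T b c a d + T b c d a + T b d a c + T b d c a +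
    T c a b d + T c a d b + T c b a d + T c b d a + T c d a b + T c d b a +
    T d a b c + T d a c b + T d b a c + T d b c a + T d c a b + T d c b a = 0 := by
  have h1 : ∀ x y, T y x x x + T x y x x + T x x y x + T x x x y = 0 := by
    intro x y
    -- T on the diagonal at x + t y is a polynomial in t whose extreme coefficients vanish. The
    -- values at t = ±1, ±2 isolate its linear coefficient.
    have e1 := h (x + y)
    have e2 := h (x + (-1 : ℝ) • y)
    have e3 := h (x + (2 : ℝ) • y)
    have e4 := h (x + (-2 : ℝ) • y)
    simp only [a₁, a₂, a₃, a₄, s₁, s₂, s₃, s₄, h] at e1 e2 e3 e4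
    linarith
  have h2 : ∀ x y z, T y z x x + T y x z x + T y x x z + T z y x x + T x y z x + T x y x z +
      T z x y x + T x z y x + T x x y z + T z x x y + T x z x y + T x x z y = 0 := by
    intro x y z
    -- Same device for a cubic in z: the odd part is isolated by ±z, and its cubic coefficient
    -- vanishes by `h1 z y`.
    have e1 := h1 (x + z) y
    have e2 := h1 (x + (-1 : ℝ) • z) y
    have e3 := h1 z y
    simp only [a₁, a₂, a₃, a₄, s₁, s₂, s₃, s₄] at e1 e2
    linarith
  have e1 := h2 (c + d) a b
  have e2 := h2 c a b
  have e3 := h2 d a b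
  simp only [a₁, a₂, a₃, a₄] at e1
  linarith

/-! ### Vanishing of R* from vanishing holomorphic sectional curvature -/

namespace HermitianAlgebra

/-- The quartic form x ↦ R(x, Jx, Jx, x) is the diagonal of R(a, Jb, Jc, d). Modulo the curvature
symmetries, R* is a linear combination of two of its polarizations. -/
theorem starTensor_eq_zero {V : Type*} [AddCommGroup V] [Module ℝ V]
    {R : V → V → V → V → ℝ} (h : IsCurvatureLike R) {J : V → V}
    (J_add : ∀ x y, J (x + y) = J x + J y) (J_smul : ∀ (t : ℝ) x, J (t • x) = t • J x)
    (J_J : ∀ x, J (J x) = -x) (hH : ∀ x, R x (J x) (J x) x = 0) (X Y Z U : V) :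
    starTensor J R X Y Z U = 0 := by
  have pol := sum_permutations_eq_zero_of_diagonal (T := fun a b c d => R a (J b) (J c) d)
    (fun _ _ _ _ _ => h.add₁ ..) (fun _ _ _ _ _ => by rw [J_add, h.add₂])
    (fun _ _ _ _ _ => by rw [J_add, h.add₃]) (fun _ _ _ _ _ => h.add₄ ..)
    (fun _ _ _ _ _ => h.smul₁ ..) (fun _ _ _ _ _ => by rw [J_smul, h.smul₂])
    (fun _ _ _ _ _ => by rw [J_smul, h.smul₃]) (fun _ _ _ _ _ => h.smul₄ ..) hH
  -- Two arguments carry a J so that, after J² = -1, every term has an even number of J's, as in R*.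
  have e1 := pol (J X) Y Z (J U)
  have e2 := pol (J X) Y (J Z) U
  simp only [J_J, h.neg₂, h.neg₃, h.permutations X Y Z U,
    h.permutations (J X) (J Y) Z U, h.permutations (J X) Y (J Z) U, h.permutations (J X) Y Z (J U),
    h.permutations X (J Y) (J Z) U, h.permutations X (J Y) Z (J U), h.permutations X Y (J Z) (J U),
    h.permutations (J X) (J Y) (J Z) (J U)] at e1 e2
  simp only [starTensor, h.permutations (J X) Y (J Z) U, h.permutations (J X) Y Z (J U),
    h.permutations X (J Y) (J Z) U, h.permutations X (J Y) Z (J U)]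
  linarith

end HermitianAlgebra

/-! ### Symmetries of the curvature of a local metric -/

namespace LocalMetric

open Filter Topology

variable {E : Type*} [NormedAddCommGroup E] [NormedSpace ℝ E]

/-- `G` is symmetric, smooth at `y₀`, and nondegenerate at `y₀`. -/
structure IsMetricAt (G : E → E →L[ℝ] E →L[ℝ] ℝ) (y₀ : E) : Prop where
  symm : ∀ y a b, G y a b = G y b a
  contDiffAt : ContDiffAt ℝ ∞ G y₀
  isInvertible : (G y₀).IsInvertible

section

variable (G : E → E →L[ℝ] E →L[ℝ] ℝ) (y : E)

theorem christoffel_add_left (a a' b : E) :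
    christoffel G y (a + a') b = christoffel G y a b + christoffel G y a' b := by
  simp only [christoffel, ← map_add, ← smul_add]
  congr 2
  ext c
  simp only [map_add, add_apply, sub_apply,
    ContinuousLinearMap.flip_apply]
  ring

theorem christoffel_smul_left (t : ℝ) (a b : E) :
    christoffel G y (t • a) b = t • christoffel G y a b := by
  simp only [christoffel, ← map_smul]
  congr 1
  ext c
  simp only [map_smul, add_apply, sub_apply,
    ContinuousLinearMap.flip_apply, smul_apply, smul_eq_mul]
  ring

theorem christoffel_zero_left (b : E) : christoffel G y 0 b = 0 := by
  simpa using christoffel_smul_left G y 0 0 b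

theorem christoffel_add_right (a b b' : E) :
    christoffel G y a (b + b') = christoffel G y a b + christoffel G y a b' := by
  simp only [christoffel, ← map_add, ← smul_add]
  congr 2
  ext c
  simp only [map_add, add_apply, sub_apply,
    ContinuousLinearMap.flip_apply]
  ring

theorem christoffel_smul_right (t : ℝ) (a b : E) :
    christoffel G y a (t • b) = t • christoffel G y a b := by
  simp only [christoffel, ← map_smul]
  congr 1
  ext c
  simp only [map_smul, add_apply, sub_apply,
    ContinuousLinearMap.flip_apply, smul_apply, smul_eq_mul]
  ring

variable {G y}

theorem fderiv_apply_symm (hs : ∀ y a b, G y a b = G y b a) (u a b : E) :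
    fderiv ℝ G y u a b = fderiv ℝ G y u b a := by
  by_cases hG : DifferentiableAt ℝ G y
  · have key : ∀ a b, fderiv ℝ (fun z => G z a b) y u = fderiv ℝ G y u a b := by
      intro a b
      rw [fderiv_clm_apply (hG.clm_apply (differentiableAt_const a)) (differentiableAt_const b),
        fderiv_clm_apply hG (differentiableAt_const a)]
      simp
    rw [← key, ← key]
    simp only [hs _ a b]
  · simp [fderiv_zero_of_not_differentiableAt hG]

theorem christoffel_symm (hs : ∀ y a b, G y a b = G y b a) (a b : E) :
    christoffel G y a b = christoffel G y b a := by
  simp only [christoffel]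
  congr 2
  ext c
  simp only [add_apply, sub_apply,
    ContinuousLinearMap.flip_apply, fderiv_apply_symm hs c a b]
  ring

theorem apply_christoffel (hi : (G y).IsInvertible) (a b c : E) :
    G y (christoffel G y a b) c =
      1 / 2 * (fderiv ℝ G y a b c + fderiv ℝ G y b a c - fderiv ℝ G y c a b) := by
  simp [christoffel, hi.self_apply_inverse]

/-- Metric compatibility of the connection: the Koszul-type formulas for the two pairings add up to
∂G. -/
theorem fderiv_apply_eq_christoffel (hs : ∀ y a b, G y a b = G y b a)
    (hi : (G y).IsInvertible) (u a b : E) :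
    fderiv ℝ G y u a b = G y (christoffel G y u a) b + G y a (christoffel G y u b) := by
  rw [hs y a, apply_christoffel hi, apply_christoffel hi, fderiv_apply_symm hs u b a]
  ring

theorem curvature_const (u v w : E) :
    curvature G (fun _ => u) (fun _ => v) (fun _ => w) y =
      fderiv ℝ (fun z => christoffel G z v w) y u + christoffel G y u (christoffel G y v w) -
      (fderiv ℝ (fun z => christoffel G z u w) y v + christoffel G y v (christoffel G y u w)) := by
  have h : ∀ v : E, covDeriv G (fun _ => v) (fun _ => w) = fun z => christoffel G z v w := by
    intro v
    ext z
    simp [covDeriv]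
  have hb : VectorField.lieBracket ℝ (fun _ : E => u) (fun _ => v) y = 0 := by
    simp [VectorField.lieBracket]
  simp only [curvature, h]
  simp [covDeriv, hb, christoffel_zero_left]

end

namespace IsMetricAt

variable [CompleteSpace E] {G : E → E →L[ℝ] E →L[ℝ] ℝ} {y : E} (hG : IsMetricAt G y)

include hG

theorem eventually_isInvertible : ∀ᶠ z in 𝓝 y, (G z).IsInvertible := by
  obtain ⟨e, he⟩ := hG.isInvertible
  have := hG.contDiffAt.continuousAt.eventually_mem (he ▸ e.nhds)
  filter_upwards [this] with z hz using hz

omit [CompleteSpace E] in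
theorem contDiffAt_fderiv : ContDiffAt ℝ 1 (fderiv ℝ G) y :=
  hG.contDiffAt.fderiv_right (m := 1) (by norm_cast)

theorem differentiableAt_christoffel (a b : E) :
    DifferentiableAt ℝ (fun z => christoffel G z a b) y := by
  have h1 : DifferentiableAt ℝ (fun z => (G z).inverse) y := by
    have := (hG.isInvertible.contDiffAt_map_inverse (n := 1)).comp y
      (hG.contDiffAt.of_le (by norm_cast))
    exact this.differentiableAt (by norm_num)
  have h2 : DifferentiableAt ℝ (fderiv ℝ G) y := hG.contDiffAt_fderiv.differentiableAt (by norm_num)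
  unfold christoffel
  refine h1.clm_apply (DifferentiableAt.fun_const_smul ?_ _)
  refine DifferentiableAt.fun_sub ?_ ?_
  · fun_prop
  · have h3 : DifferentiableAt ℝ (fun z => (fderiv ℝ G z).flip) y :=
      (ContinuousLinearMap.flipₗᵢ ℝ E E (E →L[ℝ] ℝ)).toContinuousLinearEquiv.differentiableAt.comp
        y h2
    have h4 : DifferentiableAt ℝ (fun z => ((fderiv ℝ G z).flip a).flip) y :=
      (ContinuousLinearMap.flipₗᵢ ℝ E E ℝ).toContinuousLinearEquiv.differentiableAt.comp
        y (h3.clm_apply (differentiableAt_const a))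
    exact h4.clm_apply (differentiableAt_const b)

/-- Differentiating the compatibility of the connection with the metric. -/
theorem fderiv_fderiv_apply (u v w z : E) :
    fderiv ℝ (fderiv ℝ G) y v u w z =
      G y (christoffel G y v (christoffel G y u w)) z +
      G y (christoffel G y u w) (christoffel G y v z) +
      G y (fderiv ℝ (fun x => christoffel G x u w) y v) z +
      (G y (christoffel G y v w) (christoffel G y u z) +
      G y w (christoffel G y v (christoffel G y u z)) +
      G y w (fderiv ℝ (fun x => christoffel G x u z) y v)) := by
  have hd : DifferentiableAt ℝ G y := hG.contDiffAt.differentiableAt (by simp)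
  have h2 : DifferentiableAt ℝ (fderiv ℝ G) y := hG.contDiffAt_fderiv.differentiableAt (by norm_num)
  have hc := hG.differentiableAt_christoffel
  -- Compatibility must hold near y to be differentiated; invertibility is an open condition.
  have e : (fun x => fderiv ℝ G x u w z) =ᶠ[𝓝 y]
      fun x => G x (christoffel G x u w) z + G x w (christoffel G x u z) := by
    filter_upwards [hG.eventually_isInvertible] with x hx
    exact fderiv_apply_eq_christoffel hG.symm hx u w z
  have e1 : fderiv ℝ (fun x => fderiv ℝ G x u w z) y v = fderiv ℝ (fderiv ℝ G) y v u w z := by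
    have h3 := h2.clm_apply (differentiableAt_const u)
    have h4 := h3.clm_apply (differentiableAt_const w)
    rw [fderiv_clm_apply h4 (differentiableAt_const z), fderiv_clm_apply h3
      (differentiableAt_const w), fderiv_clm_apply h2 (differentiableAt_const u)]
    simp
  have h5 := hd.clm_apply (hc u w)
  have h6 := hd.clm_apply (differentiableAt_const w)
  rw [← e1, e.fderiv_eq, fderiv_fun_add (h5.clm_apply (differentiableAt_const z))
    (h6.clm_apply (hc u z)), fderiv_clm_apply h5 (differentiableAt_const z),
    fderiv_clm_apply hd (hc u w), fderiv_clm_apply h6 (hc u z),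
    fderiv_clm_apply hd (differentiableAt_const w)]
  have hi := hG.isInvertible
  simp [fderiv_apply_eq_christoffel hG.symm hi v]
  ring

theorem isCurvatureLike : IsCurvatureLike fun u v w z : E =>
    G y (curvature G (fun _ => u) (fun _ => v) (fun _ => w) y) z where
  add₁ a a' b c d := by
    simp only [curvature_const, christoffel_add_left, christoffel_add_right,
      fderiv_fun_add (hG.differentiableAt_christoffel a c) (hG.differentiableAt_christoffel a' c),
      map_add, map_sub, add_apply, sub_apply]
    ring
  smul₁ t a b c d := by
    simp only [curvature_const, christoffel_smul_left, christoffel_smul_right,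
      fderiv_fun_const_smul (hG.differentiableAt_christoffel a c),
      map_add, map_sub, map_smul, add_apply, sub_apply,
      smul_apply, smul_eq_mul]
    ring
  swap₁₂ a b c d := by
    simp only [curvature_const, map_sub, sub_apply]
    ring
  swap₃₄ a b c d := by
    -- Expanded by compatibility, symmetry of the second derivative of G says G(R(a,b)c, d) + G(c,
    -- R(a,b)d) = 0; the mixed products G(Γ, Γ) cancel.
    have hs : fderiv ℝ (fderiv ℝ G) y a b c d = fderiv ℝ (fderiv ℝ G) y b a c d := by
      rw [(hG.contDiffAt.isSymmSndFDerivAt (by simp only [minSmoothness_of_isRCLikeNormedField]; norm_cast)).eq]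
    rw [hG.fderiv_fderiv_apply, hG.fderiv_fderiv_apply] at hs
    simp only [curvature_const, map_sub, map_add, sub_apply,
      add_apply, hG.symm y _ c]
    linarith
  bianchi a b c d := by
    simp only [curvature_const, map_sub, map_add, sub_apply,
      add_apply]
    -- Torsion-freeness makes the cyclic sum cancel term by term.
    simp only [christoffel_symm hG.symm b a, christoffel_symm hG.symm c a,
      christoffel_symm hG.symm c b]
    ring

end IsMetricAt

end LocalMetric

/-! ### The metric of an almost Hermitian manifold in a chart -/

theorem ContinuousLinearMap.isInvertible_of_pos {E : Type*} [NormedAddCommGroup E]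
    [NormedSpace ℝ E] [FiniteDimensional ℝ E] (g : E →L[ℝ] E →L[ℝ] ℝ)
    (hg : ∀ v, v ≠ 0 → 0 < g v v) : g.IsInvertible := by
  have hinj : Function.Injective (g : E →ₗ[ℝ] E →L[ℝ] ℝ) := by
    rw [← LinearMap.ker_eq_bot, LinearMap.ker_eq_bot']
    intro v hv
    by_contra h
    have h1 := hg v h
    have h2 : g v = 0 := hv
    simp [h2] at h1
  have hdim : Module.finrank ℝ E = Module.finrank ℝ (E →L[ℝ] ℝ) :=
    (Subspace.dual_finrank_eq (K := ℝ) (V := E)).symm.trans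
      (LinearMap.toContinuousLinearMap (𝕜 := ℝ) (E := E) (F' := ℝ)).finrank_eq
  refine ⟨(LinearEquiv.ofInjectiveOfFinrankEq (g : E →ₗ[ℝ] E →L[ℝ] ℝ) hinj
    hdim).toContinuousLinearEquiv, ?_⟩
  ext a b
  rfl

namespace AlmostHermitian

section

variable {E : Type*} [NormedAddCommGroup E] [NormedSpace ℝ E]
  {H : Type*} [TopologicalSpace H] {I : ModelWithCorners ℝ E H}
  {M : Type*} [TopologicalSpace M] [ChartedSpace H M] [IsManifold I ∞ M]

theorem mfderiv_extChartAt_symm_eq_symmL [I.Boundaryless] (p : M) {y : E}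
    (hy : y ∈ (extChartAt I p).target) :
    mfderiv 𝓘(ℝ, E) I (extChartAt I p).symm y =
      (trivializationAt E (TangentSpace I) p).symmL ℝ ((extChartAt I p).symm y) := by
  have h1 : (extChartAt I p).symm y ∈ (chartAt H p).source := by
    simpa using (extChartAt I p).map_target hy
  have : IsManifold I 1 M := IsManifold.of_le (n := ∞) (by norm_cast)
  rw [TangentBundle.symmL_trivializationAt h1, I.range_eq_univ, mfderivWithin_univ,
    (extChartAt I p).right_inv hy]

/-- Tangent vectors at p are coordinates in the preferred chart at p, so this derivative is a
coordinate change from a chart to itself. -/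
theorem mfderiv_extChartAt_symm_self [I.Boundaryless] (p : M) (v : E) :
    mfderiv 𝓘(ℝ, E) I (extChartAt I p).symm (extChartAt I p p) v = v := by
  have h1 := mfderiv_extChartAt_symm_eq_symmL (I := I) p (mem_extChartAt_target p)
  rw [h1]
  -- The base point equals p only propositionally, so it is generalized before substituting.
  have key : ∀ q : M, q = p →
      ((trivializationAt E (TangentSpace I) p).symmL ℝ q v : E) = v := by
    rintro q rfl
    rw [TangentBundle.symmL_trivializationAt_eq_core (mem_chart_source H q)]
    exact (tangentBundleCore I M).coordChange_self _ _ (mem_chart_source H q) v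
  exact key _ (extChartAt_to_inv p)

variable (A : AlmostHermitian I M)

theorem chartMetric_self [I.Boundaryless] (p : M) (a b : E) :
    A.chartMetric p (extChartAt I p p) a b = A.g.inner p a b := by
  have key : ∀ q : M, q = p → ∀ a b : E, A.g.inner q a b = A.g.inner p a b := by
    rintro q rfl a b
    rfl
  have h := key _ (extChartAt_to_inv (I := I) p)
    (mfderiv 𝓘(ℝ, E) I (extChartAt I p).symm (extChartAt I p p) a)
    (mfderiv 𝓘(ℝ, E) I (extChartAt I p).symm (extChartAt I p p) b)
  refine Eq.trans h ?_
  rw [mfderiv_extChartAt_symm_self, mfderiv_extChartAt_symm_self]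

theorem chartMetric_symm (p : M) (y a b : E) :
    A.chartMetric p y a b = A.chartMetric p y b a :=
  A.g.symm ((extChartAt I p).symm y) (mfderiv 𝓘(ℝ, E) I (extChartAt I p).symm y a)
    (mfderiv 𝓘(ℝ, E) I (extChartAt I p).symm y b)

variable [FiniteDimensional ℝ E]

/-- Coordinate vector fields are constant in the trivialization at p, hence smooth sections;
contracting the smooth metric with two of them is smooth. -/
theorem contDiffOn_chartMetric [I.Boundaryless] (p : M) :
    ContDiffOn ℝ ∞ (A.chartMetric p) (extChartAt I p).target := by
  rw [contDiffOn_clm_apply]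
  intro a
  rw [contDiffOn_clm_apply]
  intro b
  have hs : ContMDiffOn 𝓘(ℝ, E) I ∞ (extChartAt I p).symm (extChartAt I p).target :=
    contMDiffOn_extChartAt_symm p
  have hsec : ∀ v : E, ContMDiffOn 𝓘(ℝ, E) (I.prod 𝓘(ℝ, E)) ∞
      (fun y => (⟨(extChartAt I p).symm y, mfderiv 𝓘(ℝ, E) I (extChartAt I p).symm y v⟩ :
        TangentBundle I M)) (extChartAt I p).target := by
    intro v
    have hmem : ∀ y ∈ (extChartAt I p).target,
        (extChartAt I p).symm y ∈ (trivializationAt E (TangentSpace I) p).baseSet := by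
      intro y hy
      simpa using (extChartAt I p).map_target hy
    rw [(trivializationAt E (TangentSpace I) p).contMDiffOn_iff (fun y hy => by
      rw [Bundle.Trivialization.mem_source]
      exact hmem y hy)]
    refine ⟨hs, contMDiffOn_const (c := v) |>.congr ?_⟩
    intro y hy
    rw [mfderiv_extChartAt_symm_eq_symmL p hy]
    have h1 := (trivializationAt E (TangentSpace I) p).apply_mk_symm (hmem y hy) v
    rw [← Bundle.Trivialization.symmL_apply (R := ℝ) _ (hmem y hy)] at h1
    exact congrArg Prod.snd h1
  have h1 : ContMDiffOn 𝓘(ℝ, E) (I.prod 𝓘(ℝ, ℝ)) ∞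
      (fun y => (⟨(extChartAt I p).symm y, A.g.inner ((extChartAt I p).symm y)
        (mfderiv 𝓘(ℝ, E) I (extChartAt I p).symm y a)
        (mfderiv 𝓘(ℝ, E) I (extChartAt I p).symm y b)⟩ :
        Bundle.TotalSpace ℝ (Bundle.Trivial M ℝ))) (extChartAt I p).target :=
    ContMDiffOn.clm_bundle_apply₂ (F₁ := E) (F₂ := E)
      (A.g.contMDiff.comp_contMDiffOn hs) (hsec a) (hsec b)
  rw [← contMDiffOn_iff_contDiffOn]
  have h2 := fun y hy => (Bundle.contMDiffWithinAt_totalSpace.1 (h1 y hy)).2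
  exact h2

theorem isMetricAt_chartMetric [I.Boundaryless] (p : M) :
    LocalMetric.IsMetricAt (A.chartMetric p) (extChartAt I p p) where
  symm := A.chartMetric_symm p
  contDiffAt := (A.contDiffOn_chartMetric p).contDiffAt (extChartAt_target_mem_nhds p)
  isInvertible := ContinuousLinearMap.isInvertible_of_pos _ fun v hv => by
    rw [chartMetric_self]
    exact A.g.pos p v hv

theorem isCurvatureLike_Rm [I.Boundaryless] (p : M) : IsCurvatureLike (A.Rm p) := by
  have h := (A.isMetricAt_chartMetric p).isCurvatureLike
  simp only [chartMetric_self] at h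
  exact h

end

end AlmostHermitian

/-! ### Local metrics that split -/

namespace LocalMetric

open Filter Topology

variable {ι : Type*} [Fintype ι] {E : ι → Type*} [∀ i, NormedAddCommGroup (E i)]
  [∀ i, NormedSpace ℝ (E i)]
  {G : (∀ i, E i) → (∀ i, E i) →L[ℝ] (∀ i, E i) →L[ℝ] ℝ}
  {G' : ∀ i, E i → E i →L[ℝ] E i →L[ℝ] ℝ} {y : ∀ i, E i}

theorem fderiv_comp_eval {F : Type*} [NormedAddCommGroup F] [NormedSpace ℝ F] {i : ι}
    {f : E i → F} (hf : DifferentiableAt ℝ f (y i)) (u : ∀ i, E i) :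
    fderiv ℝ (fun z : ∀ i, E i => f (z i)) y u = fderiv ℝ f (y i) (u i) := by
  have h1 : HasFDerivAt (fun z : ∀ i, E i => z i)
      (ContinuousLinearMap.proj (R := ℝ) (φ := E) i) y :=
    (ContinuousLinearMap.proj (R := ℝ) (φ := E) i).hasFDerivAt
  have h2 := (hf.hasFDerivAt.comp y h1).fderiv
  exact congrArg (fun L : (∀ i, E i) →L[ℝ] F => L u) h2

omit [Fintype ι] in
theorem fderiv_apply_pi {F : Type*} [NormedAddCommGroup F] [NormedSpace ℝ F]
    {f : F → ∀ i, E i} {x : F} (hf : DifferentiableAt ℝ f x) (u : F) (i : ι) :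
    fderiv ℝ f x u i = fderiv ℝ (fun z => f z i) x u := by
  have h1 := (hasFDerivAt_pi'.1 hf.hasFDerivAt i).fderiv
  rw [h1]
  rfl

theorem fderiv_apply_apply {F : Type*} [NormedAddCommGroup F] [NormedSpace ℝ F]
    {f : F → F →L[ℝ] F →L[ℝ] ℝ} {x : F} (hf : DifferentiableAt ℝ f x) (a b c : F) :
    fderiv ℝ f x a b c = fderiv ℝ (fun z => f z b c) x a := by
  rw [fderiv_clm_apply (hf.clm_apply (differentiableAt_const b)) (differentiableAt_const c),
    fderiv_clm_apply hf (differentiableAt_const b)]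
  simp

theorem fderiv_eq_sum (hd : DifferentiableAt ℝ G y)
    (hd' : ∀ i, DifferentiableAt ℝ (G' i) (y i))
    (hs : ∀ᶠ z in 𝓝 y, ∀ u v, G z u v = ∑ i, G' i (z i) (u i) (v i)) (a b c : ∀ i, E i) :
    fderiv ℝ G y a b c = ∑ i, fderiv ℝ (G' i) (y i) (a i) (b i) (c i) := by
  have e : (fun z => G z b c) =ᶠ[𝓝 y] fun z => ∑ i, G' i (z i) (b i) (c i) := by
    filter_upwards [hs] with z hz using hz b c
  have hd₂ : ∀ i, DifferentiableAt ℝ (fun z => G' i z (b i) (c i)) (y i) := fun i =>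
    ((hd' i).clm_apply (differentiableAt_const _)).clm_apply (differentiableAt_const _)
  have hd₃ : ∀ i, DifferentiableAt ℝ (fun z : ∀ i, E i => G' i (z i) (b i) (c i)) y := fun i =>
    (hd₂ i).comp (f := fun z : ∀ i, E i => z i) y
      (ContinuousLinearMap.proj (R := ℝ) (φ := E) i).differentiableAt
  rw [fderiv_apply_apply hd, e.fderiv_eq, fderiv_fun_sum fun i _ => hd₃ i,
    sum_apply]
  refine Finset.sum_congr rfl fun i _ => ?_
  rw [fderiv_comp_eval (hd₂ i), fderiv_apply_apply (hd' i)]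

/-- By nondegeneracy it suffices to compare pairings with an arbitrary vector, where the defining
formula splits as a sum. -/
theorem christoffel_pi (hd : DifferentiableAt ℝ G y)
    (hd' : ∀ i, DifferentiableAt ℝ (G' i) (y i)) (hi : (G y).IsInvertible)
    (hi' : ∀ i, (G' i (y i)).IsInvertible)
    (hs : ∀ᶠ z in 𝓝 y, ∀ u v, G z u v = ∑ i, G' i (z i) (u i) (v i)) (a b : ∀ i, E i) :
    christoffel G y a b = fun i => christoffel (G' i) (y i) (a i) (b i) := by
  apply hi.injective
  ext c
  rw [apply_christoffel hi, hs.self_of_nhds]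
  simp only [fderiv_eq_sum hd hd' hs, apply_christoffel (hi' _), ← Finset.sum_add_distrib,
    ← Finset.sum_sub_distrib, Finset.mul_sum]

theorem IsMetricAt.eventually_differentiableAt {F : Type*} [NormedAddCommGroup F]
    [NormedSpace ℝ F] {g : F → F →L[ℝ] F →L[ℝ] ℝ} {x : F} (h : IsMetricAt g x) :
    ∀ᶠ z in 𝓝 x, DifferentiableAt ℝ g z := by
  have h1 := (h.contDiffAt.of_le (m := 1) (by norm_cast)).eventually (by simp)
  filter_upwards [h1] with z hz using hz.differentiableAt (by norm_num)

theorem curvature_pi [∀ i, CompleteSpace (E i)] (hG : IsMetricAt G y)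
    (hG' : ∀ i, IsMetricAt (G' i) (y i))
    (hs : ∀ᶠ z in 𝓝 y, ∀ u v, G z u v = ∑ i, G' i (z i) (u i) (v i)) (u v w : ∀ i, E i) :
    curvature G (fun _ => u) (fun _ => v) (fun _ => w) y = fun i =>
      curvature (G' i) (fun _ => u i) (fun _ => v i) (fun _ => w i) (y i) := by
  -- Curvature differentiates the Christoffel map, so its splitting is needed on a neighbourhood.
  have hev : ∀ᶠ z in 𝓝 y, ∀ a b : ∀ i, E i,
      christoffel G z a b = fun i => christoffel (G' i) (z i) (a i) (b i) := by
    have hc : ∀ i, Tendsto (fun z : ∀ i, E i => z i) (𝓝 y) (𝓝 (y i)) := fun i =>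
      (continuous_apply i).continuousAt
    filter_upwards [hG.eventually_differentiableAt, hG.eventually_isInvertible,
      eventually_all.2 fun i => (hc i).eventually (hG' i).eventually_differentiableAt,
      eventually_all.2 fun i => (hc i).eventually (hG' i).eventually_isInvertible,
      hs.eventually_nhds] with z h1 h2 h3 h4 h5 a b
    exact christoffel_pi h1 h3 h2 h4 h5 a b
  have hf : ∀ u v w : ∀ i, E i, fderiv ℝ (fun z => christoffel G z v w) y u = fun i =>
      fderiv ℝ (fun z => christoffel (G' i) z (v i) (w i)) (y i) (u i) := by
    intro u v w
    ext i
    have e : (fun z => christoffel G z v w i) =ᶠ[𝓝 y]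
        fun z => christoffel (G' i) (z i) (v i) (w i) := by
      filter_upwards [hev] with z hz using congrFun (hz v w) i
    rw [fderiv_apply_pi (hG.differentiableAt_christoffel v w), e.fderiv_eq,
      fderiv_comp_eval ((hG' i).differentiableAt_christoffel (v i) (w i))]
  ext i
  simp only [curvature_const, hf, hev.self_of_nhds, Pi.add_apply, Pi.sub_apply]

end LocalMetric

/-! ### Charts of a product manifold -/

theorem mfderiv_extChartAt_symm_eq_fderiv {E : Type*} [NormedAddCommGroup E] [NormedSpace ℝ E]
    {H : Type*} [TopologicalSpace H] {I : ModelWithCorners ℝ E H}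
    {M : Type*} [TopologicalSpace M] [ChartedSpace H M] [IsManifold I ∞ M] [I.Boundaryless]
    (p : M) {y : E} (hy : y ∈ (extChartAt I p).target) :
    DifferentiableAt ℝ
      (fun z => extChartAt I ((extChartAt I p).symm y) ((extChartAt I p).symm z)) y ∧
    ∀ v : E, (mfderiv 𝓘(ℝ, E) I (extChartAt I p).symm y v : E) =
      fderiv ℝ (fun z => extChartAt I ((extChartAt I p).symm y) ((extChartAt I p).symm z)) y v := by
  have : IsManifold I 1 M := IsManifold.of_le (n := ∞) (by norm_cast)
  have h : MDifferentiableAt 𝓘(ℝ, E) I (extChartAt I p).symm y := by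
    have := mdifferentiableWithinAt_extChartAt_symm (I := I) hy
    rwa [I.range_eq_univ, mdifferentiableWithinAt_univ] at this
  have h2 := h.differentiableWithinAt_writtenInExtChartAt
  rw [modelWithCornersSelf_coe, range_id, differentiableWithinAt_univ] at h2
  refine ⟨h2, fun v => ?_⟩
  have h3 := h.mfderiv
  rw [modelWithCornersSelf_coe, range_id, fderivWithin_univ] at h3
  exact congrArg (fun L : E →L[ℝ] E => L v) h3

section PiCharts

variable {ι : Type*} [Fintype ι]
  {E : ι → Type*} [∀ i, NormedAddCommGroup (E i)] [∀ i, NormedSpace ℝ (E i)]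
  {H : ι → Type*} [∀ i, TopologicalSpace (H i)]
  {I : ∀ i, ModelWithCorners ℝ (E i) (H i)}
  {M : ι → Type*} [∀ i, TopologicalSpace (M i)] [∀ i, ChartedSpace (H i) (M i)]

instance ModelWithCorners.pi_boundaryless [∀ i, (I i).Boundaryless] :
    (ModelWithCorners.pi I).Boundaryless where
  range_eq_univ := by
    refine Set.eq_univ_of_forall fun y => ?_
    have h : ∀ i, ∃ x, I i x = y i := fun i => by
      have : y i ∈ range (I i) := (I i).range_eq_univ ▸ mem_univ _
      exact this
    choose x hx using h
    exact ⟨x, funext hx⟩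

theorem mem_extChartAt_pi_target {x : ∀ i, M i} {y : ∀ i, E i}
    (hy : y ∈ (extChartAt (ModelWithCorners.pi I) x).target) (i : ι) :
    y i ∈ (extChartAt (I i) (x i)).target := by
  rw [extChartAt_target] at hy ⊢
  obtain ⟨h1, z, hz⟩ := hy
  exact ⟨h1 i (mem_univ i), z i, congrFun hz i⟩

/-- Preferred charts of the product are products of preferred charts, so the coordinate changes, and
their derivatives, act componentwise. -/
theorem mfderiv_extChartAt_pi_symm [∀ i, IsManifold (I i) ∞ (M i)] [∀ i, (I i).Boundaryless]
    {x : ∀ i, M i} {y : ∀ i, E i} (hy : y ∈ (extChartAt (ModelWithCorners.pi I) x).target)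
    (v : ∀ i, E i) :
    (mfderiv 𝓘(ℝ, ∀ i, E i) (ModelWithCorners.pi I) (extChartAt (ModelWithCorners.pi I) x).symm y v :
      ∀ i, E i) = fun i =>
      (mfderiv 𝓘(ℝ, E i) (I i) (extChartAt (I i) (x i)).symm (y i) (v i) : E i) := by
  obtain ⟨h1, h2⟩ := mfderiv_extChartAt_symm_eq_fderiv x hy
  refine (h2 v).trans (funext fun i => ?_)
  obtain ⟨h3, h4⟩ := mfderiv_extChartAt_symm_eq_fderiv (x i) (mem_extChartAt_pi_target hy i)
  rw [LocalMetric.fderiv_apply_pi h1, h4 (v i)]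
  exact LocalMetric.fderiv_comp_eval h3 v

end PiCharts

namespace AlmostHermitian.IsProduct

variable {ι : Type*} [Fintype ι]
  {E : ι → Type*} [∀ i, NormedAddCommGroup (E i)] [∀ i, NormedSpace ℝ (E i)]
  [∀ i, FiniteDimensional ℝ (E i)]
  {H : ι → Type*} [∀ i, TopologicalSpace (H i)]
  {I : ∀ i, ModelWithCorners ℝ (E i) (H i)} [∀ i, (I i).Boundaryless]
  {M : ι → Type*} [∀ i, TopologicalSpace (M i)] [∀ i, ChartedSpace (H i) (M i)]
  [∀ i, IsManifold (I i) ∞ (M i)]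
  {P : AlmostHermitian (ModelWithCorners.pi I) (∀ i, M i)}
  {A : ∀ i, AlmostHermitian (I i) (M i)} (hP : P.IsProduct A)

include hP

omit [∀ i, FiniteDimensional ℝ (E i)] in
theorem chartMetric_eq_sum (x : ∀ i, M i) {y : ∀ i, E i}
    (hy : y ∈ (extChartAt (ModelWithCorners.pi I) x).target) (u v : ∀ i, E i) :
    P.chartMetric x y u v = ∑ i, (A i).chartMetric (x i) (y i) (u i) (v i) := by
  have h := hP.g_eq ((extChartAt (ModelWithCorners.pi I) x).symm y)
    (fun i => mfderiv 𝓘(ℝ, E i) (I i) (extChartAt (I i) (x i)).symm (y i) (u i))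
    (fun i => mfderiv 𝓘(ℝ, E i) (I i) (extChartAt (I i) (x i)).symm (y i) (v i))
  rw [← mfderiv_extChartAt_pi_symm hy u, ← mfderiv_extChartAt_pi_symm hy v] at h
  exact h

theorem Rm_eq_sum (x : ∀ i, M i) (u v w z : ∀ i, E i) :
    P.Rm x u v w z = ∑ i, (A i).Rm (x i) (u i) (v i) (w i) (z i) := by
  have h := LocalMetric.curvature_pi (P.isMetricAt_chartMetric x)
    (fun i => (A i).isMetricAt_chartMetric (x i)) (by
      filter_upwards [extChartAt_target_mem_nhds (I := ModelWithCorners.pi I) x] with y hy u v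
      exact hP.chartMetric_eq_sum x hy u v) u v w
  let a : ∀ i, E i := fun i => LocalMetric.curvature ((A i).chartMetric (x i)) (fun _ => u i)
      (fun _ => v i) (fun _ => w i) (extChartAt (I i) (x i) (x i))
  have h2 := hP.g_eq x a z
  refine Eq.trans ?_ h2
  exact congrArg (fun a : ∀ i, E i => P.g.inner x a z) h

end AlmostHermitian.IsProduct

/-! ### Hermitian forms and the Bochner tensor of an orthogonal sum -/

namespace HermitianAlgebra

/-- A positive definite symmetric bilinear form with an orthogonal complex structure. -/
structure IsHermitianForm {V : Type*} [AddCommGroup V] [Module ℝ V]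
    (J : V → V) (g : V → V → ℝ) : Prop where
  J_add : ∀ x y, J (x + y) = J x + J y
  J_smul : ∀ (t : ℝ) x, J (t • x) = t • J x
  J_J : ∀ x, J (J x) = -x
  smul_left : ∀ (t : ℝ) x y, g (t • x) y = t * g x y
  symm : ∀ x y, g x y = g y x
  pos : ∀ x, x ≠ 0 → 0 < g x x
  g_J_J : ∀ x y, g (J x) (J y) = g x y

section

variable {V : Type*} [AddCommGroup V] [Module ℝ V] {J : V → V} {g : V → V → ℝ}
  {R : V → V → V → V → ℝ}

namespace IsHermitianForm

variable (hg : IsHermitianForm J g)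

include hg

theorem J_zero : J 0 = 0 := by
  simpa using hg.J_smul 0 0

theorem J_neg (x : V) : J (-x) = -J x := by
  simpa using hg.J_smul (-1) x

theorem zero_left (x : V) : g 0 x = 0 := by
  simpa using hg.smul_left 0 0 x

theorem zero_right (x : V) : g x 0 = 0 := by
  rw [hg.symm, hg.zero_left]

theorem neg_left (x y : V) : g (-x) y = -g x y := by
  simpa using hg.smul_left (-1) x y

theorem neg_right (x y : V) : g x (-y) = -g x y := by
  rw [hg.symm, hg.neg_left, hg.symm]

theorem self_J (x : V) : g x (J x) = 0 := by
  have h := hg.g_J_J x (J x)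
  rw [hg.J_J, hg.neg_right, hg.symm] at h
  linarith

theorem J_self (x : V) : g (J x) x = 0 := by
  rw [hg.symm, hg.self_J]

/-- Homogeneity of degree four permits normalizing u. -/
theorem holomorphic_eq_zero_of_unit (hR : IsCurvatureLike R)
    (h : ∀ u, g u u = 1 → R u (J u) (J u) u = 0) (u : V) : R u (J u) (J u) u = 0 := by
  rcases eq_or_ne u 0 with rfl | hu
  · exact hR.zero₁ _ _ _
  have hpos := hg.pos u hu
  have ht : (√(g u u))⁻¹ ≠ 0 := (inv_pos.2 (Real.sqrt_pos.2 hpos)).ne'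
  have h1 := h ((√(g u u))⁻¹ • u) (by
    rw [hg.smul_left, hg.symm u (_ • u), hg.smul_left, ← mul_assoc, ← mul_inv, Real.mul_self_sqrt hpos.le,
      inv_mul_cancel₀ hpos.ne'])
  simpa only [hg.J_smul, hR.smul₁, hR.smul₂, hR.smul₃, hR.smul₄, mul_eq_zero, ht, false_or] using h1

end IsHermitianForm

variable (hg : IsHermitianForm J g) (hR : IsCurvatureLike R)

include hg hR

theorem starTensor_zero₁ (b c d : V) : starTensor J R 0 b c d = 0 := by
  simp [starTensor, hg.J_zero, hR.zero₁, hR.zero₃]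

theorem starTensor_zero₂ (a c d : V) : starTensor J R a 0 c d = 0 := by
  simp [starTensor, hg.J_zero, hR.zero₁, hR.zero₂, hR.zero₃]

theorem starTensor_neg₄ (a b c d : V) : starTensor J R a b c (-d) = -starTensor J R a b c d := by
  simp only [starTensor, hg.J_neg, hR.neg₄]
  ring

/-- This is the normalization of R*: the four terms of weight 3/16 all equal R(x, Jx, Jx, x), as do
four of the eight of weight 1/16 with their signs, and the others vanish. -/
theorem starTensor_self_J (x : V) : starTensor J R x (J x) (J x) x = R x (J x) (J x) x := by
  simp only [starTensor, hg.J_J, hR.neg₁, hR.neg₂, hR.neg₃, hR.swap₃₄ (J x) x x (J x),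
    hR.swap₁₂ x (J x), hR.swap₃₄ x (J x) (J x) x]
  have h1 : ∀ c d, R x x c d = 0 := fun c d => by linarith [hR.swap₁₂ x x c d]
  have h2 : ∀ c d, R (J x) (J x) c d = 0 := fun c d => by linarith [hR.swap₁₂ (J x) (J x) c d]
  simp only [h1, h2]
  ring

end

/-- The generalized Bochner tensor vanishes when the holomorphic sectional curvature does. -/
theorem bochnerStar_eq_zero {V : Type*} [AddCommGroup V] [Module ℝ V] {J : V → V} {g : V → V → ℝ}
    {R : V → V → V → V → ℝ} (hg : IsHermitianForm J g) (hR : IsCurvatureLike R)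
    (hH : ∀ x, R x (J x) (J x) x = 0) {κ : Type*} [Fintype κ] (e : κ → V) (m : ℝ)
    (X Y Z U : V) : bochnerStar J g e m R X Y Z U = 0 := by
  have h := starTensor_eq_zero hR hg.J_add hg.J_smul hg.J_J hH
  simp [bochnerStar, phi, psi, ricciTrace, scalarTrace, h]

section OrthogonalSum

variable {ι : Type*} [Fintype ι] {W : ι → Type*} [∀ i, AddCommGroup (W i)] [∀ i, Module ℝ (W i)]
  {J : (∀ i, W i) → ∀ i, W i} {g : (∀ i, W i) → (∀ i, W i) → ℝ}
  {R : (∀ i, W i) → (∀ i, W i) → (∀ i, W i) → (∀ i, W i) → ℝ}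
  {J' : ∀ i, W i → W i} {g' : ∀ i, W i → W i → ℝ} {R' : ∀ i, W i → W i → W i → W i → ℝ}

omit [∀ i, AddCommGroup (W i)] [∀ i, Module ℝ (W i)] in
theorem starTensor_eq_sum (sJ : ∀ u i, J u i = J' i (u i))
    (sR : ∀ u v w z, R u v w z = ∑ i, R' i (u i) (v i) (w i) (z i)) (X Y Z U : ∀ i, W i) :
    starTensor J R X Y Z U = ∑ i, starTensor (J' i) (R' i) (X i) (Y i) (Z i) (U i) := by
  simp only [starTensor, sR, sJ, Finset.mul_sum, ← Finset.sum_add_distrib,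
    ← Finset.sum_sub_distrib]

/-- If the generalized Bochner tensor of an orthogonal sum of more than two nonzero terms vanishes,
then so does the holomorphic sectional curvature. -/
theorem holomorphic_eq_zero_of_bochnerStar_eq_zero (hι : 2 < Fintype.card ι)
    [∀ i, Nontrivial (W i)] (hg : ∀ i, IsHermitianForm (J' i) (g' i))
    (hR : ∀ i, IsCurvatureLike (R' i)) (sJ : ∀ u i, J u i = J' i (u i))
    (sg : ∀ u v, g u v = ∑ i, g' i (u i) (v i))
    (sR : ∀ u v w z, R u v w z = ∑ i, R' i (u i) (v i) (w i) (z i))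
    {κ : Type*} [Fintype κ] (e : κ → ∀ i, W i) (he : ∀ k, g (e k) (e k) = 1)
    (hB : ∀ X Y Z U, bochnerStar J g e ((Fintype.card κ : ℝ) / 2) R X Y Z U = 0)
    (u : ∀ i, W i) : R u (J u) (J u) u = 0 := by
  classical
  set m : ℝ := (Fintype.card κ : ℝ) / 2 with hm
  have hm0 : 0 ≤ m := by positivity
  set S := ricciTrace e (starTensor J R) with hS
  set τ := scalarTrace e S with hτ
  -- The frame need not be adapted to the splitting: the i-th block of S* is traced over the i-th
  -- components of all frame vectors.
  set S' : ∀ i, W i → W i → ℝ := fun i x y =>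
    ∑ k, starTensor (J' i) (R' i) x (e k i) (e k i) y with hS'
  have sS : ∀ X Y, S X Y = ∑ i, S' i (X i) (Y i) := fun X Y => by
    simp only [hS, hS', ricciTrace, starTensor_eq_sum sJ sR]
    exact Finset.sum_comm
  have S'_zero_left : ∀ i y, S' i 0 y = 0 := fun i y =>
    Finset.sum_eq_zero fun k _ => starTensor_zero₁ (hg i) (hR i) _ _ _
  have S'_neg_right : ∀ i x y, S' i x (-y) = -S' i x y := fun i x y => by
    simp only [hS', starTensor_neg₄ (hg i) (hR i), Finset.sum_neg_distrib]
  have J_single : ∀ i x, J (Pi.single i x) = Pi.single i (J' i x) := fun i x => by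
    ext j
    rw [sJ]
    exact Pi.apply_single (fun i => J' i) (fun i => (hg i).J_zero) i x j
  have g_single : ∀ i x y, g (Pi.single i x) (Pi.single i y) = g' i x y := fun i x y => by
    rw [sg, Finset.sum_eq_single i] <;> simp +contextual [(hg _).zero_left]
  have g_single_ne : ∀ i j, i ≠ j → ∀ x y, g (Pi.single i x) (Pi.single j y) = 0 := by
    intro i j hij x y
    rw [sg]
    refine Finset.sum_eq_zero fun k _ => ?_
    rcases eq_or_ne k i with rfl | hk
    · rw [Pi.single_eq_of_ne hij, (hg k).zero_right]
    · rw [Pi.single_eq_of_ne hk, (hg k).zero_left]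
  have S_single : ∀ i x y, S (Pi.single i x) (Pi.single i y) = S' i x y := fun i x y => by
    rw [sS, Finset.sum_eq_single i] <;> simp +contextual [S'_zero_left]
  have star_single : ∀ i x y z w, starTensor J R (Pi.single i x) (Pi.single i y) (Pi.single i z)
      (Pi.single i w) = starTensor (J' i) (R' i) x y z w := fun i x y z w => by
    rw [starTensor_eq_sum sJ sR, Finset.sum_eq_single i] <;>
      simp +contextual [starTensor_zero₁ (hg _) (hR _)]
  have star_single_ne : ∀ i j, i ≠ j → ∀ x y Z U,
      starTensor J R (Pi.single i x) (Pi.single j y) Z U = 0 := by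
    intro i j hij x y Z U
    rw [starTensor_eq_sum sJ sR]
    refine Finset.sum_eq_zero fun k _ => ?_
    rcases eq_or_ne k i with rfl | hk
    · rw [Pi.single_eq_of_ne hij, starTensor_zero₂ (hg k) (hR k)]
    · rw [Pi.single_eq_of_ne hk, starTensor_zero₁ (hg k) (hR k)]
  set C : ℝ := τ / (2 * (m + 1)) with hC
  -- On such a plane the ψ and π₂ terms vanish too, since J preserves the factors and g(x, Jx) = 0.
  have hmixed : ∀ i j, i ≠ j → ∀ x y,
      g' j y y * S' i x x + g' i x x * S' j y y = C * (g' i x x * g' j y y) := by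
    intro i j hij x y
    have h := hB (Pi.single i x) (Pi.single j y) (Pi.single j y) (Pi.single i x)
    simp only [bochnerStar, phi, psi, pi₁, pi₂, ← hS, ← hτ, star_single_ne i j hij, J_single,
      g_single, g_single_ne i j hij, g_single_ne j i hij.symm, S_single, (hg _).self_J] at h
    rw [hC]
    field_simp at h ⊢
    linarith
  have hdiag : ∀ i x, S' i x x = C / 2 * g' i x x := by
    intro i x
    obtain ⟨j, hj⟩ := Fintype.exists_ne_of_one_lt_card (by omega) i
    obtain ⟨k, hk⟩ : ∃ k, k ∉ ({i, j} : Finset ι) := by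
      by_contra! hall
      have h1 := Finset.card_le_card (fun a _ => hall a : Finset.univ ⊆ ({i, j} : Finset ι))
      have h2 := Finset.card_le_two (a := i) (b := j)
      rw [Finset.card_univ] at h1
      omega
    simp only [Finset.mem_insert, Finset.mem_singleton, not_or] at hk
    obtain ⟨y, hy⟩ := exists_ne (0 : W j)
    obtain ⟨z, hz⟩ := exists_ne (0 : W k)
    have hy' := (hg j).pos y hy
    have hz' := (hg k).pos z hz
    have e1 := hmixed i j hj.symm x y
    have e2 := hmixed i k (Ne.symm hk.1) x z
    have e3 := hmixed j k (Ne.symm hk.2) y z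
    have e4 : (g' j y y * g' k z z) * (S' i x x - C / 2 * g' i x x) = 0 := by
      -- With s = S*/g on each vector, the equations read s(x)+s(y) = s(x)+s(z) = s(y)+s(z) = C;
      -- this solves for s(x), denominators cleared.
      linear_combination g' k z z / 2 * e1 + g' j y y / 2 * e2 - g' i x x / 2 * e3
    rcases mul_eq_zero.1 e4 with h | h
    · exact absurd h (mul_pos hy' hz').ne'
    · linarith
  have hτ0 : τ = 0 := by
    -- The trace of (C/2) g over 2m unit vectors. Since C = τ/(2(m+1)), this leaves τ(m+2) = 0.
    have h1 : τ = m * C := by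
      rw [hτ, scalarTrace]
      simp only [sS, hdiag, ← Finset.mul_sum, ← sg, he]
      rw [Finset.sum_const, Finset.card_univ, nsmul_eq_mul, hm]
      ring
    rw [hC] at h1
    field_simp at h1
    have h2 : τ * (m + 2) = 0 := by linarith
    rcases mul_eq_zero.1 h2 with h | h
    · exact h
    · linarith
  have hS0 : ∀ i x, S' i x x = 0 := fun i x => by rw [hdiag, hC, hτ0]; simp
  have hH : ∀ i x, R' i x (J' i x) (J' i x) x = 0 := by
    intro i x
    -- For these arguments, every S* term not killed by g(x, Jx) = 0 is diagonal up to sign, so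
    -- diagonal vanishing of S* suffices.
    have h := hB (Pi.single i x) (Pi.single i (J' i x)) (Pi.single i (J' i x)) (Pi.single i x)
    simp only [bochnerStar, phi, psi, ← hS, ← hτ, hτ0, star_single, J_single,
      g_single, S_single, (hg _).J_J, S'_neg_right, hS0, (hg _).self_J, (hg _).J_self,
      (hg _).neg_right, starTensor_self_J (hg i) (hR i)] at h
    simpa using h
  rw [sR]
  refine Finset.sum_eq_zero fun i _ => ?_
  rw [sJ]
  exact hH i (u i)

end OrthogonalSum

end HermitianAlgebra

/-! ### From pointwise algebra to the manifold theorem -/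

namespace AlmostHermitian

variable {E : Type*} [NormedAddCommGroup E] [NormedSpace ℝ E]
  {H : Type*} [TopologicalSpace H] {I : ModelWithCorners ℝ E H}
  {M : Type*} [TopologicalSpace M] [ChartedSpace H M] [IsManifold I ∞ M]

theorem isHermitianForm (A : AlmostHermitian I M) (p : M) :
    HermitianAlgebra.IsHermitianForm (A.J p) (fun u v => A.g.inner p u v) where
  J_add := map_add (A.J p)
  J_smul := map_smul (A.J p)
  J_J := A.J_J p
  smul_left t x y := by simp
  symm := A.g.symm p
  pos := A.g.pos p
  g_J_J := A.g_J_J p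

theorem frame_orthonormal [FiniteDimensional ℝ E] (A : AlmostHermitian I M) (p : M)
    (i j : Fin (Module.finrank ℝ E)) :
    A.g.inner p (A.frame p i) (A.frame p j) = if i = j then 1 else 0 :=
  (A.exists_orthonormal p).choose_spec i j

end AlmostHermitian

theorem corollary2p2 {ι : Type*} [Fintype ι] (hι : 2 < Fintype.card ι)
    {E : ι → Type*} [∀ i, NormedAddCommGroup (E i)] [∀ i, NormedSpace ℝ (E i)]
    [∀ i, FiniteDimensional ℝ (E i)] [∀ i, Nontrivial (E i)]
    {H : ι → Type*} [∀ i, TopologicalSpace (H i)]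
    (I : ∀ i, ModelWithCorners ℝ (E i) (H i)) [∀ i, (I i).Boundaryless]
    (M : ι → Type*) [∀ i, TopologicalSpace (M i)] [∀ i, ChartedSpace (H i) (M i)]
    [∀ i, IsManifold (I i) ∞ (M i)]
    (A : ∀ i, AlmostHermitian (I i) (M i))
    (P : AlmostHermitian (ModelWithCorners.pi I) (∀ i, M i)) (hP : P.IsProduct A) :
    P.BstarVanishes ↔ P.ZeroHolomorphicSectionalCurvature := by
  constructor
  · intro hB p u _
    have hnt : ∀ i, Nontrivial (TangentSpace (I i) (p i)) := fun i =>
      inferInstanceAs (Nontrivial (E i))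
    refine HermitianAlgebra.holomorphic_eq_zero_of_bochnerStar_eq_zero
      (W := fun i => TangentSpace (I i) (p i)) (J := P.J p) (g := fun u v => P.g.inner p u v)
      (R := P.Rm p) hι (fun i => (A i).isHermitianForm (p i))
      (fun i => (A i).isCurvatureLike_Rm (p i)) (hP.J_eq p) (hP.g_eq p) (hP.Rm_eq_sum p)
      (P.frame p) (fun k => (P.frame_orthonormal p k k).trans (if_pos rfl)) ?_ u
    rw [Fintype.card_fin]
    exact hB p
  · intro hH p
    have hR := P.isCurvatureLike_Rm p
    have hg := P.isHermitianForm p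
    exact HermitianAlgebra.bochnerStar_eq_zero hg hR
      (hg.holomorphic_eq_zero_of_unit hR (hH p)) _ _
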